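/- Let $\mathcal I$ be $\mathbb Z$ or $\mathbb Q$ with its usual order. A *term* over $\mathcal I$ is a variable or a constant from $\mathcal I$ (rational constants are given by numerator and denominator), and an *ordering atom* is an expression $t\mathrel{\rho}t'$ with terms $t,t'$ and $\rho\in\{<,\le,>,\ge,=,\ne\}$. An *assignment* $\delta$ maps variables to elements of $\mathcal I$ and is extended to constants by the identity. A finite conjunction $L$ of ordering atoms *entails* an atom if every assignment satisfying $L$ satisfies that atom. $L$ is a *complete ordering* of a set $T$ of terms with respect to $\mathcal I$ if for all $t,t'\in T$ exactly one of $t<t'$, $t>t'$, $t=t'$ is entailed by $L$. An *ordered identity* for a function $\alpha$ on finite bags (multisets) over $\mathcal I$ is a formula $L\to\alpha(B)=\alpha(B')$, where $L$ is a complete ordering of some set of terms $T$ and $B,B'$ are finite bags of terms from $T$; it is *valid* if $\alpha(\delta(B))=\alpha(\delta(B'))$ for every assignment $\delta$ that satisfies $L$. The function $\alpha$ is *order-decidable* over $\mathcal I$ if there is an algorithm that decides, given a formula $L\to\alpha(B)=\alpha(B')$, whether it is a valid ordered identity. Let $\mathrm{SUM}(B)$ be the sum of the elements of a bag $B$ (with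 multiplicity; $0$ for the empty bag), and let $\mathrm{AVG}(B)\in\mathbb Q$ be $\mathrm{SUM}(B)/|B|$ for non-empty $B$. On the empty bag $\mathrm{AVG}$ has a special value "undefined", which is equal to itself and different from every number. **Proposition.** Both $\mathrm{SUM}$ and $\mathrm{AVG}$ are order-decidable over $\mathbb Z$ and over $\mathbb Q$. -/

import Mathlib

/-! ### Syntax: terms, ordering atoms, conditional identities -/

/-- A term over the domain `D` is a variable (`Sum.inl n`, the `n`-th variable) or a constant
from `D` (`Sum.inr d`). -/
abbrev OTerm (D : Type) : Type := ℕ ⊕ D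

/-- The ordering predicates `<`, `≤`, `>`, `≥`, `=`, `≠`. -/
inductive OrdPred : Type
  | lt | le | gt | ge | eq | ne

/-- The six ordering predicates, numbered in the order in which they are listed. -/
def OrdPred.equivFin : OrdPred ≃ Fin 6 where
  toFun
    | .lt => 0
    | .le => 1
    | .gt => 2
    | .ge => 3
    | .eq => 4
    | .ne => 5
  invFun i := match i with
    | 0 => .lt
    | 1 => .le
    | 2 => .gt
    | 3 => .ge
    | 4 => .eq
    | 5 => .ne
  left_inv p := by cases p <;> rfl
  right_inv i := by fin_cases i <;> rfl

instance OrdPred.instPrimcodable : Primcodable OrdPred := Primcodable.ofEquiv (Fin 6) OrdPred.equivFin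

/-- An ordering atom `t ρ t'`. -/
abbrev OAtom (D : Type) : Type := OTerm D × OrdPred × OTerm D

/-- A formula `L → α(B) = α(B')`, written as the triple `(L, B, B')`: `L` is a conjunction of
ordering atoms, and `B`, `B'` are finite bags of terms, each written down as a list of its
elements with multiplicities. -/
abbrev CondIdentity (D : Type) : Type := List (OAtom D) × List (OTerm D) × List (OTerm D)

/-! ### Semantics -/

section Semantics

variable {D : Type} [LinearOrder D]

/-- The meaning of the ordering predicates in a linearly ordered domain. -/
def OrdPred.Holds : OrdPred → D → D → Prop
  | .lt, a, b => a < b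
  | .le, a, b => a ≤ b
  | .gt, a, b => a > b
  | .ge, a, b => a ≥ b
  | .eq, a, b => a = b
  | .ne, a, b => a ≠ b

/-- The value of a term under an assignment; constants denote themselves. -/
def OTerm.eval (δ : ℕ → D) : OTerm D → D := Sum.elim δ id

/-- The assignment `δ` satisfies the atom `t ρ t'`. -/
def OAtom.Sat (δ : ℕ → D) (a : OAtom D) : Prop :=
  a.2.1.Holds (OTerm.eval δ a.1) (OTerm.eval δ a.2.2)

/-- The assignment `δ` satisfies every atom of the conjunction `L`. -/
def SatConj (δ : ℕ → D) (L : List (OAtom D)) : Prop := ∀ a ∈ L, OAtom.Sat δ a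

/-- `L` entails the atom `a` with respect to the domain `D`. -/
def Entails (L : List (OAtom D)) (a : OAtom D) : Prop :=
  ∀ δ : ℕ → D, SatConj δ L → OAtom.Sat δ a

/-- `L` is a complete ordering of the set of terms `T` with respect to `D`: for all `t`, `t'` in
`T`, exactly one of `t < t'`, `t > t'`, `t = t'` is entailed by `L`. -/
def IsCompleteOrdering (L : List (OAtom D)) (T : Set (OTerm D)) : Prop :=
  ∀ t ∈ T, ∀ t' ∈ T,
    (Entails L (t, .lt, t') ∧ ¬ Entails L (t, .gt, t') ∧ ¬ Entails L (t, .eq, t')) ∨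
    (¬ Entails L (t, .lt, t') ∧ Entails L (t, .gt, t') ∧ ¬ Entails L (t, .eq, t')) ∨
    (¬ Entails L (t, .lt, t') ∧ ¬ Entails L (t, .gt, t') ∧ Entails L (t, .eq, t'))

/-- `L → α(B) = α(B')` is an ordered identity: `L` is a complete ordering of some set of terms
from which all elements of `B` and of `B'` are taken. -/
def IsOrderedIdentity (φ : CondIdentity D) : Prop :=
  ∃ T : Set (OTerm D), IsCompleteOrdering φ.1 T ∧ (∀ t ∈ φ.2.1, t ∈ T) ∧ (∀ t ∈ φ.2.2, t ∈ T)

/-- The bag `δ(B)` of elements of the domain. -/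
def evalBag (δ : ℕ → D) (B : List (OTerm D)) : Multiset D :=
  Multiset.map (OTerm.eval δ) (B : Multiset (OTerm D))

/-- The formula `L → α(B) = α(B')` is valid: under every assignment that satisfies `L`, the
aggregation function `α` yields the same value on `δ(B)` and on `δ(B')`. -/
def ValidIdentity {V : Type} (α : Multiset D → V) (φ : CondIdentity D) : Prop :=
  ∀ δ : ℕ → D, SatConj δ φ.1 → α (evalBag δ φ.2.1) = α (evalBag δ φ.2.2)

/-- The (unary) aggregation function `α` is order-decidable over `D`: there is an algorithm
that decides, given a formula `L → α(B) = α(B')`, whether it is a valid ordered identity. -/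
def OrderDecidable [Primcodable D] {V : Type} (α : Multiset D → V) : Prop :=
  ComputablePred fun φ : CondIdentity D => IsOrderedIdentity φ ∧ ValidIdentity α φ

end Semantics

/-! ### Rational constants, written as fractions in lowest terms

The integers carry the encoding of Mathlib. A rational number is encoded by its numerator and
denominator. -/

/-- Pairs (numerator, denominator) in lowest terms. -/
abbrev ReducedFraction : Type := {p : ℤ × ℕ // p.2 ≠ 0 ∧ p.1.natAbs.Coprime p.2}

/-- A rational number is determined by its numerator and denominator. -/
def ratEquivReducedFraction : ℚ ≃ ReducedFraction where
  toFun q := ⟨(q.num, q.den), q.den_nz, q.reduced⟩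
  invFun p := ⟨p.1.1, p.1.2, p.2.1, p.2.2⟩
  left_inv _ := rfl
  right_inv _ := rfl

theorem primrec_int_natAbs : Primrec Int.natAbs := by
  have h : Primrec fun z : ℤ => (Encodable.encode z + 1) / 2 :=
    Primrec.nat_div.comp (Primrec.succ.comp Primrec.encode) (Primrec.const 2)
  refine h.of_eq fun z => ?_
  cases z with
  | ofNat n =>
    have e : Encodable.encode (Int.ofNat n) = 2 * n := rfl
    rw [e, Int.natAbs_ofNat']
    omega
  | negSucc n =>
    have e : Encodable.encode (Int.negSucc n) = 2 * n + 1 := rfl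
    rw [e, Int.natAbs_negSucc]
    omega

theorem primrecPred_coprime : PrimrecPred fun p : ℕ × ℕ => p.1.Coprime p.2 := by
  have hR : PrimrecRel fun (d : ℕ) (p : ℕ × ℕ) => p.1 % d = 0 → p.2 % d = 0 → d = 1 := by
    have h1 : PrimrecPred fun x : ℕ × ℕ × ℕ => x.2.1 % x.1 = 0 :=
      Primrec.eq.comp (Primrec.nat_mod.comp (Primrec.fst.comp Primrec.snd) Primrec.fst)
        (Primrec.const 0)
    have h2 : PrimrecPred fun x : ℕ × ℕ × ℕ => x.2.2 % x.1 = 0 :=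
      Primrec.eq.comp (Primrec.nat_mod.comp (Primrec.snd.comp Primrec.snd) Primrec.fst)
        (Primrec.const 0)
    have h3 : PrimrecPred fun x : ℕ × ℕ × ℕ => x.1 = 1 :=
      Primrec.eq.comp Primrec.fst (Primrec.const 1)
    have h4 : PrimrecPred fun x : ℕ × ℕ × ℕ => x.2.1 % x.1 = 0 → x.2.2 % x.1 = 0 → x.1 = 1 :=
      (h1.not.or (h2.not.or h3)).of_eq fun x => by tauto
    exact h4
  have h : PrimrecPred fun p : ℕ × ℕ =>
      ∀ d ∈ List.range (p.1 + p.2).succ, p.1 % d = 0 → p.2 % d = 0 → d = 1 := by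
    exact hR.forall_mem_list.comp
      (Primrec.list_range.comp (Primrec.succ.comp (Primrec.nat_add.comp Primrec.fst Primrec.snd)))
      (Primrec.id : Primrec fun p : ℕ × ℕ => p)
  refine PrimrecPred.of_eq h fun p => ?_
  obtain ⟨a, b⟩ := p
  simp only [List.mem_range, ← Nat.dvd_iff_mod_eq_zero]
  constructor
  · intro H
    refine H (Nat.gcd a b) ?_ (Nat.gcd_dvd_left a b) (Nat.gcd_dvd_right a b)
    rcases Nat.eq_zero_or_pos a with rfl | ha
    · simp
    · have := Nat.gcd_le_left b ha
      omega
  · intro H d _ hda hdb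
    exact Nat.eq_one_of_dvd_coprimes H hda hdb

theorem primrecPred_reducedFraction :
    PrimrecPred fun p : ℤ × ℕ => p.2 ≠ 0 ∧ p.1.natAbs.Coprime p.2 := by
  have h1 : PrimrecPred fun p : ℤ × ℕ => p.2 = 0 :=
    Primrec.eq.comp Primrec.snd (Primrec.const 0)
  have h2 : PrimrecPred fun p : ℤ × ℕ => p.1.natAbs.Coprime p.2 :=
    primrecPred_coprime.comp
      (Primrec.pair (primrec_int_natAbs.comp Primrec.fst) Primrec.snd)
  exact h1.not.and h2

instance instPrimcodableReducedFraction : Primcodable ReducedFraction :=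
  Primcodable.subtype primrecPred_reducedFraction

instance instPrimcodableRat : Primcodable ℚ :=
  Primcodable.ofEquiv ReducedFraction ratEquivReducedFraction

/-! ### Aggregation functions -/

/-- The average of a bag of rational numbers; it has no value (`none`) on the empty bag. -/
def avgRat (B : Multiset ℚ) : Option ℚ :=
  if B.card = 0 then none else some (B.sum / (B.card : ℚ))

/-- The average of a bag of integers, which is a rational number. -/
def avgInt (B : Multiset ℤ) : Option ℚ := avgRat (B.map fun z => (z : ℚ))

/-- The sum of a bag of integers. -/
def sumInt (B : Multiset ℤ) : ℤ := B.sum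

/-- The sum of a bag of rational numbers. -/
def sumRat (B : Multiset ℚ) : ℚ := B.sum

/-! It suffices to test finitely many assignments that can be computed from the formula. Let `E` be
the code of the formula. Every term in it has code at most `E`, so only the variables with index at
most `E` and the constants with code at most `E` matter. Composing an assignment with a map `k` that
fixes these constants and is strictly increasing on the values of the terms does not change which
atoms hold. `HasBoundedRescalings` provides such a `k` with values of bounded code, which makes
satisfiability and entailment, hence complete orderings, decidable.

Rescaling does not preserve equality of sums, but `p · SUM(k(δ(B))) - q · SUM(k(δ(B')))` is linear
in `k`. The bounded map `g` leaves enough room to raise its value at any single point outside the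
fixed set `C` by `ε`. If the functional vanished at `g` and at all these perturbations, it would
vanish at the indicator of every point outside `C`. On the term values `id - g` is a combination of
such indicators, so the functional would vanish at `id` too. Hence every counterexample yields a
bounded one (`exists_isRescaling_ne_zero`).

Both aggregates fit this scheme (`IsSumComparable`): equality of averages becomes, after
cross-multiplication, an equation between sums whose coefficients are cardinalities, and these do
not depend on the assignment. The resulting test is primitive recursive. -/

/-! ### Primitive recursive arithmetic on integers and rationals -/

theorem encode_int_natCast (n : ℕ) : Encodable.encode (n : ℤ) = 2 * n := rfl

theorem encode_int_negSucc (n : ℕ) : Encodable.encode (Int.negSucc n) = 2 * n + 1 := rfl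

theorem natAbs_le_encode (z : ℤ) : z.natAbs ≤ Encodable.encode z := by
  cases z with
  | ofNat n => have := encode_int_natCast n; simp_all; omega
  | negSucc n => rw [encode_int_negSucc, Int.natAbs_negSucc]; omega

theorem encode_int_le (z : ℤ) : Encodable.encode z ≤ 2 * z.natAbs := by
  cases z with
  | ofNat n => have := encode_int_natCast n; simp_all
  | negSucc n => rw [encode_int_negSucc, Int.natAbs_negSucc]; omega

theorem primrec_int_toNat : Primrec Int.toNat := by
  have h : Primrec fun z : ℤ =>
      if Encodable.encode z % 2 = 0 then Encodable.encode z / 2 else 0 :=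
    Primrec.ite (Primrec.eq.comp (Primrec.nat_mod.comp Primrec.encode (Primrec.const 2))
      (Primrec.const 0)) (Primrec.nat_div.comp Primrec.encode (Primrec.const 2)) (Primrec.const 0)
  refine h.of_eq fun z => ?_
  cases z with
  | ofNat n => have := encode_int_natCast n; simp_all
  | negSucc n => rw [encode_int_negSucc, if_neg (by omega)]; rfl

/-- The code of the difference is explicit: `2n` for `n ≥ 0` and `2n + 1` for `-(n + 1)`. Negation,
addition and multiplication reduce to this case by writing integers as differences of natural
numbers. -/
theorem primrec_int_subNatNat : Primrec₂ fun a b : ℕ => (a : ℤ) - b := by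
  refine Primrec.encode_iff.1 ?_
  have h : Primrec fun p : ℕ × ℕ =>
      if p.2 ≤ p.1 then 2 * (p.1 - p.2) else 2 * (p.2 - p.1 - 1) + 1 :=
    Primrec.ite (Primrec.nat_le.comp Primrec.snd Primrec.fst)
      (Primrec.nat_mul.comp (Primrec.const 2) (Primrec.nat_sub.comp Primrec.fst Primrec.snd))
      (Primrec.succ.comp (Primrec.nat_mul.comp (Primrec.const 2)
        (Primrec.nat_sub.comp (Primrec.nat_sub.comp Primrec.snd Primrec.fst) (Primrec.const 1))))
  refine h.of_eq fun p => ?_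
  split_ifs with hp
  · rw [← encode_int_natCast, Nat.cast_sub hp]
  · rw [← encode_int_negSucc]
    congr 1
    dsimp only
    omega

theorem primrec_int_neg : Primrec fun z : ℤ => -z := by
  have h : Primrec fun z : ℤ => (((z.natAbs - z.toNat : ℕ) : ℤ) - (z.toNat : ℕ) : ℤ) :=
    primrec_int_subNatNat.comp
      (Primrec.nat_sub.comp primrec_int_natAbs primrec_int_toNat) primrec_int_toNat
  exact h.of_eq fun z => by omega

theorem primrec_int_add : Primrec₂ fun a b : ℤ => a + b := by
  have t1 : Primrec fun p : ℤ × ℤ => p.1.toNat := primrec_int_toNat.comp Primrec.fst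
  have t2 : Primrec fun p : ℤ × ℤ => p.2.toNat := primrec_int_toNat.comp Primrec.snd
  have s1 : Primrec fun p : ℤ × ℤ => (-p.1).toNat :=
    primrec_int_toNat.comp (primrec_int_neg.comp Primrec.fst)
  have s2 : Primrec fun p : ℤ × ℤ => (-p.2).toNat :=
    primrec_int_toNat.comp (primrec_int_neg.comp Primrec.snd)
  have h := primrec_int_subNatNat.comp (Primrec.nat_add.comp t1 t2) (Primrec.nat_add.comp s1 s2)
  exact h.of_eq fun p => by push_cast; omega

theorem primrec_int_mul : Primrec₂ fun a b : ℤ => a * b := by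
  have t1 : Primrec fun p : ℤ × ℤ => p.1.toNat := primrec_int_toNat.comp Primrec.fst
  have t2 : Primrec fun p : ℤ × ℤ => p.2.toNat := primrec_int_toNat.comp Primrec.snd
  have s1 : Primrec fun p : ℤ × ℤ => (-p.1).toNat :=
    primrec_int_toNat.comp (primrec_int_neg.comp Primrec.fst)
  have s2 : Primrec fun p : ℤ × ℤ => (-p.2).toNat :=
    primrec_int_toNat.comp (primrec_int_neg.comp Primrec.snd)
  have h := primrec_int_subNatNat.comp
    (Primrec.nat_add.comp (Primrec.nat_mul.comp t1 t2) (Primrec.nat_mul.comp s1 s2))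
    (Primrec.nat_add.comp (Primrec.nat_mul.comp t1 s2) (Primrec.nat_mul.comp s1 t2))
  refine h.of_eq fun p => ?_
  have e1 := Int.toNat_sub_toNat_neg p.1
  have e2 := Int.toNat_sub_toNat_neg p.2
  push_cast
  conv_rhs => rw [← e1, ← e2]
  ring

theorem primrec_natCast_int : Primrec fun n : ℕ => (n : ℤ) :=
  (primrec_int_subNatNat.comp Primrec.id (Primrec.const 0)).of_eq fun n => by simp

theorem primrecRel_int_lt : PrimrecRel fun a b : ℤ => a < b := by
  have h : PrimrecPred fun p : ℤ × ℤ => 0 < (p.2 + -p.1).toNat :=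
    Primrec.nat_lt.comp (Primrec.const 0)
      (primrec_int_toNat.comp (primrec_int_add.comp Primrec.snd (primrec_int_neg.comp Primrec.fst)))
  exact h.of_eq fun p => by omega

/-! ### Rational arithmetic by numerators and denominators -/

theorem encode_rat (q : ℚ) :
    Encodable.encode q = Nat.pair (Encodable.encode q.num) q.den := rfl

theorem primrec_rat_num_den : Primrec fun q : ℚ => (q.num, q.den) := by
  have h1 : Primrec ratEquivReducedFraction := Primrec.of_equiv
  exact (Primrec.subtype_val (hp := primrecPred_reducedFraction)).comp h1

theorem primrecRel_rat_lt : PrimrecRel fun a b : ℚ => a < b := by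
  have n1 : Primrec fun p : ℚ × ℚ => (p.1.num, p.1.den) := primrec_rat_num_den.comp Primrec.fst
  have n2 : Primrec fun p : ℚ × ℚ => (p.2.num, p.2.den) := primrec_rat_num_den.comp Primrec.snd
  have h : PrimrecPred fun p : ℚ × ℚ => p.1.num * (p.2.den : ℤ) < p.2.num * (p.1.den : ℤ) :=
    primrecRel_int_lt.comp
      (primrec_int_mul.comp (Primrec.fst.comp n1) (primrec_natCast_int.comp (Primrec.snd.comp n2)))
      (primrec_int_mul.comp (Primrec.fst.comp n2) (primrec_natCast_int.comp (Primrec.snd.comp n1)))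
  exact h.of_eq fun p => (Rat.lt_iff _ _).symm

theorem primrec_int_list_sum : Primrec fun l : List ℤ => l.sum := by
  have h : Primrec fun l : List ℤ => l.foldr (fun b s => b + s) 0 :=
    Primrec.list_foldr Primrec.id (Primrec.const 0)
      (primrec_int_add.comp (Primrec.fst.comp Primrec.snd) (Primrec.snd.comp Primrec.snd)).to₂
  exact h.of_eq fun l => by induction l <;> simp_all

/-- A numerator and a positive denominator of the sum of a list of rational numbers, not
necessarily in lowest terms. -/
def ratListSumFraction (l : List ℚ) : ℤ × ℕ :=
  l.foldr (fun q s => (q.num * (s.2 : ℤ) + s.1 * (q.den : ℤ), q.den * s.2)) (0, 1)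

theorem primrec_ratListSumFraction : Primrec ratListSumFraction := by
  unfold ratListSumFraction
  refine Primrec.list_foldr (α := List ℚ)
    (h := fun _ (p : ℚ × ℤ × ℕ) => (p.1.num * (p.2.2 : ℤ) + p.2.1 * (p.1.den : ℤ), p.1.den * p.2.2))
    Primrec.id (Primrec.const ((0 : ℤ), (1 : ℕ))) ?_
  have q : Primrec fun p : List ℚ × ℚ × ℤ × ℕ => (p.2.1.num, p.2.1.den) :=
    primrec_rat_num_den.comp (Primrec.fst.comp Primrec.snd)
  have s : Primrec fun p : List ℚ × ℚ × ℤ × ℕ => p.2.2 := Primrec.snd.comp Primrec.snd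
  exact (Primrec.pair
    (primrec_int_add.comp
      (primrec_int_mul.comp (Primrec.fst.comp q) (primrec_natCast_int.comp (Primrec.snd.comp s)))
      (primrec_int_mul.comp (Primrec.fst.comp s) (primrec_natCast_int.comp (Primrec.snd.comp q))))
    (Primrec.nat_mul.comp (Primrec.snd.comp q) (Primrec.snd.comp s))).to₂

theorem ratListSumFraction_spec (l : List ℚ) :
    (ratListSumFraction l).2 ≠ 0 ∧
      l.sum = ((ratListSumFraction l).1 : ℚ) / ((ratListSumFraction l).2 : ℚ) := by
  induction l with
  | nil => simp [ratListSumFraction]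
  | cons q l ih =>
    obtain ⟨h0, h⟩ := ih
    have e : ratListSumFraction (q :: l) =
      (q.num * ((ratListSumFraction l).2 : ℤ) + (ratListSumFraction l).1 * (q.den : ℤ),
        q.den * (ratListSumFraction l).2) := rfl
    rw [e]
    refine ⟨Nat.mul_ne_zero q.den_nz h0, ?_⟩
    have hq : (q.den : ℚ) ≠ 0 := by exact_mod_cast q.den_nz
    have h0' : ((ratListSumFraction l).2 : ℚ) ≠ 0 := by exact_mod_cast h0
    rw [List.sum_cons, h]
    nth_rewrite 1 [← Rat.num_div_den q]
    push_cast
    field_simp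

/-- Equality of natural multiples of the sums of two lists is primitive recursive. -/
def PrimrecSumEq (D : Type) [Semiring D] [Primcodable D] : Prop :=
  PrimrecPred fun x : (ℕ × ℕ) × List D × List D =>
    (x.1.1 : D) * x.2.1.sum = (x.1.2 : D) * x.2.2.sum

theorem primrecSumEq_int : PrimrecSumEq ℤ :=
  Primrec.eq.comp
    (primrec_int_mul.comp (primrec_natCast_int.comp (Primrec.fst.comp Primrec.fst))
      (primrec_int_list_sum.comp (Primrec.fst.comp Primrec.snd)))
    (primrec_int_mul.comp (primrec_natCast_int.comp (Primrec.snd.comp Primrec.fst))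
      (primrec_int_list_sum.comp (Primrec.snd.comp Primrec.snd)))

/-- Unreduced fractions are compared by cross-multiplication, so no sum has to be brought to lowest
terms. -/
theorem primrecSumEq_rat : PrimrecSumEq ℚ := by
  have s1 : Primrec fun x : (ℕ × ℕ) × List ℚ × List ℚ => ratListSumFraction x.2.1 :=
    primrec_ratListSumFraction.comp (Primrec.fst.comp Primrec.snd)
  have s2 : Primrec fun x : (ℕ × ℕ) × List ℚ × List ℚ => ratListSumFraction x.2.2 :=
    primrec_ratListSumFraction.comp (Primrec.snd.comp Primrec.snd)
  have h : PrimrecPred fun x : (ℕ × ℕ) × List ℚ × List ℚ =>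
      (x.1.1 : ℤ) * ((ratListSumFraction x.2.1).1 * ((ratListSumFraction x.2.2).2 : ℤ)) =
        (x.1.2 : ℤ) * ((ratListSumFraction x.2.2).1 * ((ratListSumFraction x.2.1).2 : ℤ)) :=
    Primrec.eq.comp
      (primrec_int_mul.comp (primrec_natCast_int.comp (Primrec.fst.comp Primrec.fst))
        (primrec_int_mul.comp (Primrec.fst.comp s1) (primrec_natCast_int.comp (Primrec.snd.comp s2))))
      (primrec_int_mul.comp (primrec_natCast_int.comp (Primrec.snd.comp Primrec.fst))
        (primrec_int_mul.comp (Primrec.fst.comp s2) (primrec_natCast_int.comp (Primrec.snd.comp s1))))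
  refine h.of_eq fun x => ?_
  obtain ⟨h1, e1⟩ := ratListSumFraction_spec x.2.1
  obtain ⟨h2, e2⟩ := ratListSumFraction_spec x.2.2
  have h1' : ((ratListSumFraction x.2.1).2 : ℚ) ≠ 0 := by exact_mod_cast h1
  have h2' : ((ratListSumFraction x.2.2).2 : ℚ) ≠ 0 := by exact_mod_cast h2
  rw [e1, e2, mul_div_assoc', mul_div_assoc', div_eq_div_iff h1' h2', ← @Int.cast_inj ℚ]
  push_cast
  constructor <;> intro h <;> linarith

/-! ### Rescaling finitely many values into a bounded set -/

section Counting

variable {D : Type} [LinearOrder D]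

theorem card_filter_Ioc_mono (S : Finset D) (a : D) {v w : D} (h : v ≤ w) :
    (S.filter fun x => a < x ∧ x ≤ v).card ≤ (S.filter fun x => a < x ∧ x ≤ w).card := by
  refine Finset.card_le_card fun x hx => ?_
  simp only [Finset.mem_filter] at hx ⊢
  exact ⟨hx.1, hx.2.1, hx.2.2.trans h⟩

theorem card_filter_Ico_anti (S : Finset D) (a : D) {v w : D} (h : v ≤ w) :
    (S.filter fun x => w ≤ x ∧ x < a).card ≤ (S.filter fun x => v ≤ x ∧ x < a).card := by
  refine Finset.card_le_card fun x hx => ?_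
  simp only [Finset.mem_filter] at hx ⊢
  exact ⟨hx.1, h.trans hx.2.1, hx.2.2⟩

theorem card_filter_Ioc_lt {S : Finset D} {a v w : D} (h : v < w) (hw : w ∈ S) (ha : a < w) :
    (S.filter fun x => a < x ∧ x ≤ v).card < (S.filter fun x => a < x ∧ x ≤ w).card := by
  refine Finset.card_lt_card ((Finset.ssubset_iff_of_subset fun x hx => ?_).2 ⟨w, ?_, ?_⟩)
  · simp only [Finset.mem_filter] at hx ⊢
    exact ⟨hx.1, hx.2.1, hx.2.2.trans h.le⟩
  · simp [hw, ha]
  · simp [h]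

theorem card_filter_Ico_lt {S : Finset D} {a v w : D} (h : v < w) (hv : v ∈ S) (ha : v < a) :
    (S.filter fun x => w ≤ x ∧ x < a).card < (S.filter fun x => v ≤ x ∧ x < a).card := by
  refine Finset.card_lt_card ((Finset.ssubset_iff_of_subset fun x hx => ?_).2 ⟨v, ?_, ?_⟩)
  · simp only [Finset.mem_filter] at hx ⊢
    exact ⟨hx.1, h.le.trans hx.2.1, hx.2.2⟩
  · simp [hv, ha]
  · simp [h]

theorem card_filter_Ioc_eq_zero (S : Finset D) {a v : D} (h : v ≤ a) :
    (S.filter fun x => a < x ∧ x ≤ v).card = 0 := by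
  rw [Finset.card_eq_zero, Finset.filter_eq_empty_iff]
  exact fun x _ hx => absurd (hx.1.trans_le hx.2) h.not_gt

theorem card_filter_Ico_eq_zero (S : Finset D) {a v : D} (h : a ≤ v) :
    (S.filter fun x => v ≤ x ∧ x < a).card = 0 := by
  rw [Finset.card_eq_zero, Finset.filter_eq_empty_iff]
  exact fun x _ hx => absurd (hx.1.trans_lt hx.2) h.not_gt

end Counting

/-- Any `E + 1` values can be moved to values with codes at most `W E` by a map that is strictly
monotone on them, fixes a set `C` containing every element with code at most `E`, and
stays strictly monotone when the image of a single value outside `C` is increased by `ε`. -/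
def HasBoundedRescalings (D : Type) [LinearOrder D] [Ring D] [Encodable D] (W : ℕ → ℕ) : Prop :=
  ∀ (E : ℕ) (S : Finset D), S.card ≤ E + 1 → ∃ (C : Set D) (g : D → D) (ε : D), 0 < ε ∧
    (∀ d, Encodable.encode d ≤ E → d ∈ C) ∧ (∀ d ∈ C, g d = d) ∧
    (∀ v w, (v ∈ S ∨ v ∈ C) → (w ∈ S ∨ w ∈ C) → v < w → g v < g w ∧ (v ∉ C → g v + ε < g w)) ∧
    ∀ v, Encodable.encode (g v) ≤ W E ∧ Encodable.encode (g v + ε) ≤ W E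

/-- The interval `[-E, E]` is fixed; a value of `S` beyond an endpoint is placed at twice its rank
from that endpoint. The factor 2 leaves room for `ε = 1`; only two points of `C` can have images one
apart. The bound is twice `E + 2(E + 1) + 1`. -/
theorem hasBoundedRescalings_int : HasBoundedRescalings ℤ fun E => 6 * E + 6 := by
  intro E S hS
  have hU : ∀ v : ℤ, (S.filter fun x => (E : ℤ) < x ∧ x ≤ v).card ≤ E + 1 :=
    fun v => (Finset.card_filter_le _ _).trans hS
  have hL : ∀ v : ℤ, (S.filter fun x => v ≤ x ∧ x < -(E : ℤ)).card ≤ E + 1 :=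
    fun v => (Finset.card_filter_le _ _).trans hS
  refine ⟨Set.Icc (-E) E, fun v => max (-(E : ℤ)) (min E v) +
    2 * ((S.filter fun x => (E : ℤ) < x ∧ x ≤ v).card : ℤ) -
    2 * ((S.filter fun x => v ≤ x ∧ x < -(E : ℤ)).card : ℤ), 1, one_pos, ?_, ?_, ?_, ?_⟩
  · intro d hd
    have := natAbs_le_encode d
    rw [Set.mem_Icc]
    omega
  · intro d hd
    rw [Set.mem_Icc] at hd
    dsimp only
    rw [card_filter_Ioc_eq_zero S hd.2, card_filter_Ico_eq_zero S hd.1]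
    omega
  · intro v w hv hw h
    simp only [Set.mem_Icc] at hv hw ⊢
    have m1 := card_filter_Ioc_mono S (E : ℤ) h.le
    have m2 := card_filter_Ico_anti S (-(E : ℤ)) h.le
    by_cases c1 : (E : ℤ) < w
    · have := card_filter_Ioc_lt h (hw.resolve_right (by omega)) c1
      omega
    by_cases c2 : v < -(E : ℤ)
    · have := card_filter_Ico_lt h (hv.resolve_right (by omega)) c2
      omega
    omega
  · intro v
    have h1 := hU v
    have h2 := hL v
    constructor
    all_goals
      refine (encode_int_le _).trans ?_
      dsimp only
      omega

/-! ### Rescaling of rational values -/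

theorem nat_pair_le_pair {a b c d : ℕ} (h1 : a ≤ c) (h2 : b ≤ d) : Nat.pair a b ≤ Nat.pair c d := by
  refine le_trans (b := Nat.pair c b) ?_ ?_
  · rcases h1.eq_or_lt with rfl | h
    · exact le_rfl
    · exact (Nat.pair_lt_pair_left b h).le
  · rcases h2.eq_or_lt with rfl | h
    · exact le_rfl
    · exact (Nat.pair_lt_pair_right c h).le

/-- Reducing a fraction with positive denominator increases neither the absolute value of its
numerator nor its denominator. -/
theorem encode_rat_div_le {k : ℤ} {Q A : ℕ} (hQ : 0 < Q) (hk : k.natAbs ≤ A) :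
    Encodable.encode ((k : ℚ) / (Q : ℚ)) ≤ Nat.pair (2 * A) Q := by
  have hd : ((k : ℚ) / (Q : ℚ)).den ∣ Q := by
    have := Rat.den_dvd k Q
    rw [← Rat.intCast_div_eq_divInt] at this
    exact_mod_cast this
  have hn : ((k : ℚ) / (Q : ℚ)).num.natAbs ≤ k.natAbs := by
    rcases eq_or_ne k 0 with rfl | hk0
    · simp
    have := Rat.num_dvd k (b := (Q : ℤ)) (by exact_mod_cast hQ.ne')
    rw [← Rat.intCast_div_eq_divInt] at this
    exact Nat.le_of_dvd (Int.natAbs_pos.2 hk0) (Int.natAbs_dvd_natAbs.2 (by exact_mod_cast this))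
  rw [encode_rat]
  refine nat_pair_le_pair ((encode_int_le _).trans ?_) (Nat.le_of_dvd hQ hd)
  omega

/-- The grid of mesh `1 / E!` on `[-E, E]` contains every rational of code at most `E` and is fixed.
Each cell is cut into `2(E + 2)` parts. The at most `E + 1` values of `S` in a cell go to even
positions, the last being at most `2E + 2`, so a shift by one part stays below the next grid point.
Values beyond the ends are ranked in the same way. -/
theorem hasBoundedRescalings_rat : HasBoundedRescalings ℚ fun E =>
    Nat.pair (2 * (2 * (E + 2) * (E * E.factorial) + 2 * E + 3)) (2 * (E + 2) * E.factorial) := by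
  intro E S hS
  set D : ℕ := E.factorial with hD
  have hD0 : 0 < D := E.factorial_pos
  have hDq : (0 : ℚ) < D := by exact_mod_cast hD0
  have hQ0 : 0 < 2 * (E + 2) * D := by positivity
  have hQq : (0 : ℚ) < ((2 * (E + 2) * D : ℕ) : ℚ) := by exact_mod_cast hQ0
  -- `z v / D` is the largest grid point not above `v`, or `-E` when `v < -E`.
  set z : ℚ → ℤ := fun v => max (-((E * D : ℕ) : ℤ)) (min ((E * D : ℕ) : ℤ) ⌊(D : ℚ) * v⌋) with hz
  set U : ℚ → ℕ := fun v => (S.filter fun x => (z v : ℚ) / D < x ∧ x ≤ v).card with hU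
  set L : ℚ → ℕ := fun v => (S.filter fun x => v ≤ x ∧ x < -(E : ℚ)).card with hL
  have hUle : ∀ v, U v ≤ E + 1 := fun v => (Finset.card_filter_le _ _).trans hS
  have hLle : ∀ v, L v ≤ E + 1 := fun v => (Finset.card_filter_le _ _).trans hS
  have hzlow : ∀ v, -((E * D : ℕ) : ℤ) ≤ z v := fun v => le_max_left _ _
  have hzup : ∀ v, z v ≤ ((E * D : ℕ) : ℤ) := fun v => by simp only [hz]; omega
  have hzmono : ∀ v w, v ≤ w → z v ≤ z w := fun v w h =>
    max_le_max le_rfl (min_le_min le_rfl (Int.floor_le_floor (by gcongr)))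
  have hzlow' : ∀ v, -(E : ℚ) ≤ (z v : ℚ) / D := fun v => by
    rw [le_div_iff₀ hDq]
    have := hzlow v
    have : ((-((E * D : ℕ) : ℤ) : ℤ) : ℚ) ≤ z v := by exact_mod_cast this
    push_cast at this
    linarith
  have hlow : ∀ v, v < (z v : ℚ) / D → z v = -((E * D : ℕ) : ℤ) := fun v h => by
    rw [lt_div_iff₀ hDq] at h
    have : ⌊(D : ℚ) * v⌋ < z v := Int.floor_lt.2 (by linarith)
    simp only [hz] at this ⊢
    omega
  refine ⟨{v | (z v : ℚ) / D = v}, fun v => ((2 * (E + 2) * z v + 2 * U v - 2 * L v : ℤ) : ℚ) /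
    ((2 * (E + 2) * D : ℕ) : ℚ), 1 / ((2 * (E + 2) * D : ℕ) : ℚ), by positivity, ?_, ?_, ?_, ?_⟩
  · intro d hd
    rw [encode_rat] at hd
    have h1 : d.num.natAbs ≤ E :=
      (natAbs_le_encode _).trans ((Nat.left_le_pair _ _).trans hd)
    have h2 : d.den ≤ E := (Nat.right_le_pair _ _).trans hd
    obtain ⟨m, hm⟩ := Nat.dvd_factorial d.den_pos h2
    have e : (D : ℚ) * d = ((m * d.num : ℤ) : ℚ) := by
      have hq : d * d.den = d.num := Rat.mul_den_eq_num d
      rw [hD, hm]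
      push_cast
      rw [← hq]
      ring
    have hmD : m ≤ D := by
      rw [hD, hm]
      exact Nat.le_mul_of_pos_left m d.den_pos
    have hb : (m * d.num).natAbs ≤ E * D := by
      rw [Int.natAbs_mul, Int.natAbs_natCast, mul_comm]
      exact Nat.mul_le_mul h1 hmD
    have hzd : z d = m * d.num := by
      simp only [hz, e, Int.floor_intCast]
      omega
    rw [Set.mem_ofPred_eq, hzd, ← e]
    field_simp
  · intro d hd
    rw [Set.mem_ofPred_eq] at hd
    have u0 : U d = 0 := card_filter_Ioc_eq_zero S hd.ge
    have l0 : L d = 0 := card_filter_Ico_eq_zero S (hd ▸ hzlow' d)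
    dsimp only
    rw [u0, l0]
    conv_rhs => rw [← hd]
    push_cast
    field_simp
    ring
  · intro v w hv hw h
    simp only [Set.mem_ofPred_eq] at hv hw
    have key : 2 * ((E : ℤ) + 2) * z v + 2 * U v - 2 * L v + 1 <
        2 * ((E : ℤ) + 2) * z w + 2 * U w - 2 * L w := by
      have ml : L w ≤ L v := card_filter_Ico_anti S _ h.le
      -- Between different grid points the step `2(E + 2)` exceeds `2 * U v + 1 ≤ 2E + 3`; over a
      -- common grid point the ranks decide.
      rcases (hzmono v w h.le).lt_or_eq with hlt | heq
      · have lw : L w = 0 := by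
          refine card_filter_Ico_eq_zero S ?_
          by_contra hw'
          have h1 : w < (z w : ℚ) / D := (not_le.1 hw').trans_le (hzlow' w)
          have := hlow w h1
          have := hzlow v
          omega
        have := hUle v
        have : 2 * ((E : ℤ) + 2) * (z v + 1) ≤ 2 * ((E : ℤ) + 2) * z w := by gcongr; omega
        rw [lw]
        push_cast
        nlinarith
      · have mu : U v ≤ U w := by
          simp only [hU, heq]
          exact card_filter_Ioc_mono S _ h.le
        rw [heq]
        by_cases c : (z w : ℚ) / D < w
        · have : U v < U w := by
            simp only [hU, heq]
            exact card_filter_Ioc_lt h (hw.resolve_right c.ne) c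
          omega
        -- Now `v` lies strictly below its own grid point, which happens only to the left of `-E`.
        · have c1 : v < (z v : ℚ) / D := by rw [heq]; exact h.trans_le (not_lt.1 c)
          have c2 : v < -(E : ℚ) := by
            have h1 := c1
            rw [hlow v c1, lt_div_iff₀ hDq] at h1
            push_cast at h1
            nlinarith
          have : L w < L v := card_filter_Ico_lt h (hv.resolve_right c1.ne') c2
          omega
    have key' : ((2 * ((E : ℤ) + 2) * z v + 2 * U v - 2 * L v + 1 : ℤ) : ℚ) <
        ((2 * ((E : ℤ) + 2) * z w + 2 * U w - 2 * L w : ℤ) : ℚ) := by exact_mod_cast key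
    refine ⟨?_, fun _ => ?_⟩
    · refine (div_lt_div_iff_of_pos_right hQq).2 (lt_trans ?_ key')
      exact_mod_cast lt_add_one _
    · rw [← add_div]
      refine (div_lt_div_iff_of_pos_right hQq).2 (lt_of_eq_of_lt ?_ key')
      push_cast
      ring
  · intro v
    have h1 := hUle v
    have h2 := hLle v
    have h3 : (2 * ((E : ℤ) + 2) * z v).natAbs ≤ 2 * (E + 2) * (E * D) := by
      rw [Int.natAbs_mul]
      have := hzlow v
      have := hzup v
      refine Nat.mul_le_mul (by omega) (by omega)
    constructor
    · exact encode_rat_div_le hQ0 (by rw [← hD]; omega)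
    · have e : ((2 * ((E : ℤ) + 2) * z v + 2 * U v - 2 * L v : ℤ) : ℚ) /
          ((2 * (E + 2) * D : ℕ) : ℚ) + 1 / ((2 * (E + 2) * D : ℕ) : ℚ) =
          ((2 * ((E : ℤ) + 2) * z v + 2 * U v - 2 * L v + 1 : ℤ) : ℚ) /
            ((2 * (E + 2) * D : ℕ) : ℚ) := by
        rw [← add_div]
        push_cast
        ring
      dsimp only
      rw [e]
      exact encode_rat_div_le hQ0 (by rw [← hD]; omega)

/-! ### Bounded assignments suffice -/

section Bounded

variable {D : Type}

/-- The values under `δ` of the terms with code at most `E`. -/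
def termValues [Primcodable D] (δ : ℕ → D) (E : ℕ) : Set D :=
  {v | ∃ t : OTerm D, Encodable.encode t ≤ E ∧ OTerm.eval δ t = v}

/-- The map `k` preserves the order of the values of terms with code at most `E`, fixes
the constants among them, and sends the values of variables to elements with code at most `w`. -/
structure IsRescaling [LinearOrder D] [Primcodable D] (w E : ℕ) (δ : ℕ → D) (k : D → D) : Prop where
  fix : ∀ d, Encodable.encode d ≤ E → k d = d
  mono : StrictMonoOn k (termValues δ E)
  code : ∀ i ≤ E, Encodable.encode (k (δ i)) ≤ w

/-- The variable `i` has code `2i`, and a constant has one more than twice its own code. -/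
theorem termValues_cases [LinearOrder D] [Primcodable D] {δ : ℕ → D} {E : ℕ} {v : D}
    (h : v ∈ termValues δ E) :
    v ∈ (Finset.range (E + 1)).image δ ∨ Encodable.encode v ≤ E := by
  obtain ⟨t | d, ht, rfl⟩ := h
  · left
    rw [Encodable.encode_inl, Encodable.encode_nat] at ht
    exact Finset.mem_image_of_mem δ (Finset.mem_range.2 (by omega))
  · right
    rw [Encodable.encode_inr] at ht
    change Encodable.encode d ≤ E
    omega

theorem exists_isRescaling [LinearOrder D] [CommRing D] [Primcodable D] {W : ℕ → ℕ}
    (hW : HasBoundedRescalings D W) (E : ℕ) (δ : ℕ → D) :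
    ∃ k, IsRescaling (W E) E δ k := by
  obtain ⟨C, g, ε, -, hC, hfix, hmono, hcode⟩ :=
    hW E ((Finset.range (E + 1)).image δ) (Finset.card_image_le.trans (by simp))
  exact ⟨g, fun d hd => hfix d (hC d hd), fun v hv w hw h =>
    (hmono v w ((termValues_cases hv).imp_right (hC v)) ((termValues_cases hw).imp_right (hC w))
      h).1, fun i _ => (hcode _).1⟩

/-- A linear functional that is zero at `g` and at every `g + ε • Pi.single v 1` with `v ∉ C` kills
all these indicators, and so takes the same value at `id` as at `g`, namely zero. -/
theorem exists_isRescaling_ne_zero [LinearOrder D] [CommRing D] [IsStrictOrderedRing D]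
    [Primcodable D] {W : ℕ → ℕ} (hW : HasBoundedRescalings D W)
    (E : ℕ) (δ : ℕ → D) (h : (D → D) →ₗ[D] D)
    (hloc : ∀ k k', Set.EqOn k k' (termValues δ E) → h k = h k') (hid : h id ≠ 0) :
    ∃ k, IsRescaling (W E) E δ k ∧ h k ≠ 0 := by
  by_contra! hzero
  set S := (Finset.range (E + 1)).image δ with hS
  obtain ⟨C, g, ε, hε, hC, hfix, hmono, hcode⟩ := hW E S (Finset.card_image_le.trans (by simp))
  have hcase : ∀ v ∈ termValues δ E, v ∈ S ∨ v ∈ C := fun v hv =>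
    (termValues_cases hv).imp_right (hC v)
  have hg : h g = 0 := hzero g ⟨fun d hd => hfix d (hC d hd), fun v hv w hw hvw =>
    (hmono v w (hcase v hv) (hcase w hw) hvw).1, fun i _ => (hcode _).1⟩
  have hsingle : ∀ v, v ∉ C → h (Pi.single v 1) = 0 := by
    intro v hvC
    have hk : IsRescaling (W E) E δ (g + ε • Pi.single v 1) := by
      have e : ∀ x, (g + ε • Pi.single v 1 : D → D) x = if x = v then g x + ε else g x := by
        intro x
        by_cases hx : x = v <;> simp [hx]
      refine ⟨fun d hd => ?_, fun x hx y hy hxy => ?_, fun i _ => ?_⟩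
      · rw [e, if_neg, hfix d (hC d hd)]
        rintro rfl
        exact hvC (hC d hd)
      · have hlt := hmono x y (hcase x hx) (hcase y hy) hxy
        rw [e, e]
        split_ifs with h1 h2 h2
        · exact absurd (h1.trans h2.symm) hxy.ne
        · exact hlt.2 (h1 ▸ hvC)
        · exact lt_add_of_lt_of_pos' hlt.1 hε
        · exact hlt.1
      · rw [e]
        split_ifs
        · exact (hcode _).2
        · exact (hcode _).1
    have := hzero _ hk
    rw [map_add, map_smul, hg, zero_add, smul_eq_mul] at this
    exact (mul_eq_zero.1 this).resolve_left hε.ne'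
  classical
  refine hid ?_
  -- `id - g` vanishes on `C`, and every term value outside `C` lies in `S`; by locality other
  -- points are irrelevant.
  have e : h (id - g) = h (∑ v ∈ S with v ∉ C, (v - g v) • Pi.single v 1) := by
    refine hloc _ _ fun w hw => ?_
    simp only [Pi.sub_apply, id, Finset.sum_apply, Pi.smul_apply, Pi.single_apply, smul_eq_mul,
      mul_ite, mul_one, mul_zero, Finset.sum_ite_eq, Finset.mem_filter]
    split_ifs with hw'
    · rfl
    · rw [hfix w, sub_self]
      have := hcase w hw
      tauto
  rw [map_sub, hg, sub_zero, map_sum] at e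
  rw [e]
  refine Finset.sum_eq_zero fun v hv => ?_
  rw [map_smul, hsingle v (Finset.mem_filter.1 hv).2, smul_zero]

/-! ### Finite lists as bounded assignments -/

/-- The assignment that reads the values of the variables from a list. -/
def listAssignment [Zero D] (l : List D) (i : ℕ) : D := l.getD i 0

/-- A bound for the codes of lists of length `n` whose entries have codes at most `w`. -/
def listCodeBound (w n : ℕ) : ℕ := Nat.rec 0 (fun _ x => (Nat.pair w x).succ) n

theorem encode_list_le [Primcodable D] {w : ℕ} (l : List D) (h : ∀ x ∈ l, Encodable.encode x ≤ w) :
    Encodable.encode l ≤ listCodeBound w l.length := by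
  induction l with
  | nil => exact le_rfl
  | cons x l ih =>
    rw [Encodable.encode_list_cons]
    exact Nat.succ_le_succ (nat_pair_le_pair (h x (by simp)) (ih fun y hy => h y (by simp [hy])))

/-- The finitely many lists whose codes do not exceed the bound determined by `w` and `E`. -/
def boundedLists (D : Type) [Primcodable D] (w E : ℕ) : List (List D) :=
  (List.range (listCodeBound w (E + 1) + 1)).filterMap Encodable.decode

/-- A list of length `E + 1` suffices: variables that receive the default `0` have codes above `E`.
-/
theorem IsRescaling.exists_list [LinearOrder D] [CommRing D] [Primcodable D] {w E : ℕ} {δ : ℕ → D}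
    {k : D → D} (hk : IsRescaling w E δ k) :
    ∃ l ∈ boundedLists D w E, ∀ t : OTerm D, Encodable.encode t ≤ E →
      OTerm.eval (listAssignment l) t = k (OTerm.eval δ t) := by
  refine ⟨(List.range (E + 1)).map fun i => k (δ i), ?_, ?_⟩
  · refine List.mem_filterMap.2 ⟨_, List.mem_range.2 (Nat.lt_succ_of_le ?_), Encodable.encodek _⟩
    have := encode_list_le (w := w) ((List.range (E + 1)).map fun i => k (δ i)) (by
      intro x hx
      obtain ⟨i, hi, rfl⟩ := List.mem_map.1 hx
      exact hk.code i (Nat.lt_succ_iff.1 (List.mem_range.1 hi)))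
    simpa using this
  · rintro (i | d) ht
    · rw [Encodable.encode_inl, Encodable.encode_nat] at ht
      have : i < E + 1 := by omega
      simp [OTerm.eval, listAssignment, this]
    · rw [Encodable.encode_inr] at ht
      exact (hk.fix d (by omega)).symm

theorem OrdPred.holds_iff_of_strictMonoOn [LinearOrder D] {s : Set D} {k : D → D}
    (hk : StrictMonoOn k s)
    (ρ : OrdPred) {x y : D} (hx : x ∈ s) (hy : y ∈ s) : ρ.Holds (k x) (k y) ↔ ρ.Holds x y := by
  cases ρ
  · exact hk.lt_iff_lt hx hy
  · exact hk.le_iff_le hx hy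
  · exact hk.lt_iff_lt hy hx
  · exact hk.le_iff_le hy hx
  · exact hk.injOn.eq_iff hx hy
  · exact (hk.injOn.eq_iff hx hy).not

theorem IsRescaling.sat_iff [LinearOrder D] [Primcodable D] {w E : ℕ} {δ δ' : ℕ → D} {k : D → D}
    (hk : IsRescaling w E δ k)
    (h : ∀ t : OTerm D, Encodable.encode t ≤ E → OTerm.eval δ' t = k (OTerm.eval δ t))
    {a : OAtom D} (h1 : Encodable.encode a.1 ≤ E) (h2 : Encodable.encode a.2.2 ≤ E) :
    OAtom.Sat δ' a ↔ OAtom.Sat δ a := by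
  unfold OAtom.Sat
  rw [h _ h1, h _ h2]
  exact OrdPred.holds_iff_of_strictMonoOn hk.mono _ ⟨_, h1, rfl⟩ ⟨_, h2, rfl⟩

theorem encode_le_of_mem {α : Type} [Encodable α] {x : α} {l : List α} (h : x ∈ l) :
    Encodable.encode x ≤ Encodable.encode l := by
  induction l with
  | nil => simp at h
  | cons y l ih =>
    rw [Encodable.encode_list_cons]
    rcases List.mem_cons.1 h with rfl | h
    · exact (Nat.left_le_pair _ _).trans (Nat.le_succ _)
    · exact (ih h).trans ((Nat.right_le_pair _ _).trans (Nat.le_succ _))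

theorem CondIdentity.encode_le [Primcodable D] (φ : CondIdentity D) :
    (∀ a ∈ φ.1, Encodable.encode a.1 ≤ Encodable.encode φ ∧
      Encodable.encode a.2.2 ≤ Encodable.encode φ) ∧
    (∀ t ∈ φ.2.1, Encodable.encode t ≤ Encodable.encode φ) ∧
    (∀ t ∈ φ.2.2, Encodable.encode t ≤ Encodable.encode φ) := by
  obtain ⟨L, B, B'⟩ := φ
  have e : Encodable.encode (L, B, B') = Nat.pair (Encodable.encode L)
    (Nat.pair (Encodable.encode B) (Encodable.encode B')) := rfl
  rw [e]
  refine ⟨?_, fun t ht => ?_, fun t ht => ?_⟩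
  · rintro ⟨t, ρ, t'⟩ ha
    have h := (encode_le_of_mem ha).trans (Nat.left_le_pair _
      (Nat.pair (Encodable.encode B) (Encodable.encode B')))
    have e : Encodable.encode (t, ρ, t') = Nat.pair (Encodable.encode t)
      (Nat.pair (Encodable.encode ρ) (Encodable.encode t')) := rfl
    rw [e] at h
    exact ⟨(Nat.left_le_pair _ _).trans h,
      (Nat.right_le_pair _ _).trans ((Nat.right_le_pair _ _).trans h)⟩
  · exact (encode_le_of_mem ht).trans ((Nat.left_le_pair _ _).trans (Nat.right_le_pair _ _))
  · exact (encode_le_of_mem ht).trans ((Nat.right_le_pair _ _).trans (Nat.right_le_pair _ _))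

theorem exists_bounded_satConj [LinearOrder D] [CommRing D] [Primcodable D] {W : ℕ → ℕ}
    (hW : HasBoundedRescalings D W) (φ : CondIdentity D)
    {δ : ℕ → D} (hδ : SatConj δ φ.1) :
    ∃ l ∈ boundedLists D (W (Encodable.encode φ)) (Encodable.encode φ),
      SatConj (listAssignment l) φ.1 ∧
      ∀ a : OAtom D, Encodable.encode a.1 ≤ Encodable.encode φ →
        Encodable.encode a.2.2 ≤ Encodable.encode φ →
          (OAtom.Sat (listAssignment l) a ↔ OAtom.Sat δ a) := by
  obtain ⟨k, hk⟩ := exists_isRescaling hW (Encodable.encode φ) δ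
  obtain ⟨l, hl, h⟩ := hk.exists_list
  exact ⟨l, hl, fun a ha => (hk.sat_iff h (φ.encode_le.1 a ha).1 (φ.encode_le.1 a ha).2).2 (hδ a ha),
    fun a h1 h2 => hk.sat_iff h h1 h2⟩

/-- `p · SUM(k(δ(B))) - q · SUM(k(δ(B')))` as a linear function of `k`. -/
def sumDifference [CommRing D] (p q : D) (δ : ℕ → D) (B B' : List (OTerm D)) : (D → D) →ₗ[D] D :=
  p • (B.map fun t => LinearMap.proj (R := D) (φ := fun _ : D => D) (OTerm.eval δ t)).sum -
    q • (B'.map fun t => LinearMap.proj (R := D) (φ := fun _ : D => D) (OTerm.eval δ t)).sum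

theorem sum_map_proj_apply [CommRing D] (δ : ℕ → D) (B : List (OTerm D)) (k : D → D) :
    (B.map fun t => LinearMap.proj (R := D) (φ := fun _ : D => D) (OTerm.eval δ t)).sum k =
      (B.map fun t => k (OTerm.eval δ t)).sum := by
  induction B with
  | nil => rfl
  | cons t B ih => simp [ih]

theorem sumDifference_apply [CommRing D] (p q : D) (δ : ℕ → D) (B B' : List (OTerm D)) (k : D → D) :
    sumDifference p q δ B B' k = p * (B.map fun t => k (OTerm.eval δ t)).sum -
      q * (B'.map fun t => k (OTerm.eval δ t)).sum := by
  simp only [sumDifference, LinearMap.sub_apply, LinearMap.smul_apply, smul_eq_mul,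
    sum_map_proj_apply]

theorem exists_bounded_sum_ne [LinearOrder D] [CommRing D] [IsStrictOrderedRing D] [Primcodable D]
    {W : ℕ → ℕ} (hW : HasBoundedRescalings D W)
    (φ : CondIdentity D) {δ : ℕ → D} (hδ : SatConj δ φ.1) {p q : D}
    (hne : p * (φ.2.1.map (OTerm.eval δ)).sum ≠ q * (φ.2.2.map (OTerm.eval δ)).sum) :
    ∃ l ∈ boundedLists D (W (Encodable.encode φ)) (Encodable.encode φ),
      SatConj (listAssignment l) φ.1 ∧
      p * (φ.2.1.map (OTerm.eval (listAssignment l))).sum ≠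
        q * (φ.2.2.map (OTerm.eval (listAssignment l))).sum := by
  obtain ⟨k, hk, hne'⟩ := exists_isRescaling_ne_zero hW (Encodable.encode φ) δ
    (sumDifference p q δ φ.2.1 φ.2.2) (by
      intro k k' hkk
      rw [sumDifference_apply, sumDifference_apply,
        List.map_congr_left fun t ht => hkk ⟨t, φ.encode_le.2.1 t ht, rfl⟩,
        List.map_congr_left fun t ht => hkk ⟨t, φ.encode_le.2.2 t ht, rfl⟩])
    (by rw [sumDifference_apply]; exact sub_ne_zero.2 hne)
  obtain ⟨l, hl, h⟩ := hk.exists_list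
  refine ⟨l, hl, fun a ha =>
    (hk.sat_iff h (φ.encode_le.1 a ha).1 (φ.encode_le.1 a ha).2).2 (hδ a ha), ?_⟩
  rw [List.map_congr_left fun t ht => h t (φ.encode_le.2.1 t ht),
    List.map_congr_left fun t ht => h t (φ.encode_le.2.2 t ht)]
  rw [sumDifference_apply] at hne'
  exact sub_ne_zero.1 hne'

end Bounded

/-! ### Deciding validity of ordered identities -/

section Decision

variable {D : Type}

/-- The set `T` can be shrunk to the terms of the two bags. An unsatisfiable conjunction entails all
three relations, so it orders only the empty set completely, and then both bags are empty. For a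
satisfiable one, at most one relation is entailed automatically. -/
theorem isOrderedIdentity_and_valid_iff [LinearOrder D] {V : Type} (α : Multiset D → V)
    (φ : CondIdentity D) :
    (IsOrderedIdentity φ ∧ ValidIdentity α φ) ↔ φ.2.1 ++ φ.2.2 = [] ∨
      (∃ δ, SatConj δ φ.1) ∧
      (∀ t ∈ φ.2.1 ++ φ.2.2, ∀ t' ∈ φ.2.1 ++ φ.2.2,
        Entails φ.1 (t, .lt, t') ∨ Entails φ.1 (t, .gt, t') ∨ Entails φ.1 (t, .eq, t')) ∧
      ValidIdentity α φ := by
  obtain ⟨L, B, B'⟩ := φ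
  simp only [IsOrderedIdentity]
  constructor
  · rintro ⟨⟨T, hT, hB, hB'⟩, hv⟩
    have hmem : ∀ t ∈ B ++ B', t ∈ T := fun t ht => (List.mem_append.1 ht).elim (hB t) (hB' t)
    by_cases hs : ∃ δ, SatConj δ L
    · refine .inr ⟨hs, fun t ht t' ht' => ?_, hv⟩
      have := hT t (hmem t ht) t' (hmem t' ht')
      tauto
    · refine .inl (List.eq_nil_iff_forall_not_mem.2 fun t ht => ?_)
      have he : ∀ a, Entails L a := fun a δ hδ => absurd ⟨δ, hδ⟩ hs
      have := hT t (hmem t ht) t (hmem t ht)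
      have := he (t, .lt, t)
      have := he (t, .gt, t)
      tauto
  · rintro (h | ⟨⟨δ, hδ⟩, hT, hv⟩)
    · obtain ⟨rfl, rfl⟩ := List.append_eq_nil_iff.1 h
      exact ⟨⟨∅, fun t ht => ht.elim, by simp, by simp⟩, fun δ _ => rfl⟩
    · refine ⟨⟨{t | t ∈ B ++ B'}, fun t ht t' ht' => ?_, fun t ht => List.mem_append_left _ ht,
        fun t ht => List.mem_append_right _ ht⟩, hv⟩
      have hlt : Entails L (t, .lt, t') → OTerm.eval δ t < OTerm.eval δ t' := fun h => h δ hδ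
      have hgt : Entails L (t, .gt, t') → OTerm.eval δ t' < OTerm.eval δ t := fun h => h δ hδ
      have heq : Entails L (t, .eq, t') → OTerm.eval δ t = OTerm.eval δ t' := fun h => h δ hδ
      rcases hT t ht t' ht' with h | h | h
      · exact .inl ⟨h, fun h' => (hlt h).not_gt (hgt h'), fun h' => (hlt h).ne (heq h')⟩
      · exact .inr (.inl ⟨fun h' => (hlt h').not_gt (hgt h), h, fun h' => (hgt h).ne' (heq h')⟩)
      · exact .inr (.inr ⟨fun h' => (hlt h').ne (heq h), fun h' => (hgt h').ne' (heq h), h⟩)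

/-- The function `α` takes equal values on two bags exactly when their cardinalities satisfy `κ` and
multiples of their sums, with coefficients depending on the cardinalities, agree. -/
def IsSumComparable [CommRing D] {V : Type} (α : Multiset D → V) (κ : ℕ → ℕ → Prop)
    (p q : ℕ → ℕ → ℕ) : Prop :=
  ∀ m m' : Multiset D, α m = α m' ↔ κ m.card m'.card ∧
    (p m.card m'.card : D) * m.sum = (q m.card m'.card : D) * m'.sum

/-- The condition `α(δ(B)) = α(δ(B'))` expressed by cardinalities and sums. -/
def SumCondition [CommRing D] (κ : ℕ → ℕ → Prop) (p q : ℕ → ℕ → ℕ) (φ : CondIdentity D) (δ : ℕ → D)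
    : Prop :=
  κ φ.2.1.length φ.2.2.length ∧
    (p φ.2.1.length φ.2.2.length : D) * (φ.2.1.map (OTerm.eval δ)).sum =
      (q φ.2.1.length φ.2.2.length : D) * (φ.2.2.map (OTerm.eval δ)).sum

theorem IsSumComparable.eq_iff [CommRing D] {V : Type} {α : Multiset D → V} {κ : ℕ → ℕ → Prop}
    {p q : ℕ → ℕ → ℕ} (hα : IsSumComparable α κ p q) (φ : CondIdentity D) (δ : ℕ → D) :
    α (evalBag δ φ.2.1) = α (evalBag δ φ.2.2) ↔ SumCondition κ p q φ δ := by
  rw [hα]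
  simp [evalBag, SumCondition]

/-- Every list is a genuine assignment, so surplus lists in `boundedLists` do no harm; the converse
is rescaling. -/
theorem entails_iff_bounded [LinearOrder D] [CommRing D] [Primcodable D] {W : ℕ → ℕ}
    (hW : HasBoundedRescalings D W) (φ : CondIdentity D)
    (ρ : OrdPred) {t t' : OTerm D} (ht : t ∈ φ.2.1 ++ φ.2.2) (ht' : t' ∈ φ.2.1 ++ φ.2.2) :
    Entails φ.1 (t, ρ, t') ↔
      ∀ l ∈ boundedLists D (W (Encodable.encode φ)) (Encodable.encode φ),
        SatConj (listAssignment l) φ.1 → OAtom.Sat (listAssignment l) (t, ρ, t') := by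
  refine ⟨fun h l _ hl => h _ hl, fun h δ hδ => ?_⟩
  obtain ⟨l, hl, hs, hiff⟩ := exists_bounded_satConj hW φ hδ
  have hmem : ∀ t ∈ φ.2.1 ++ φ.2.2, Encodable.encode t ≤ Encodable.encode φ := fun t ht =>
    (List.mem_append.1 ht).elim (φ.encode_le.2.1 t) (φ.encode_le.2.2 t)
  exact (hiff _ (hmem t ht) (hmem t' ht')).1 (h l hl hs)

theorem valid_iff_bounded [LinearOrder D] [CommRing D] [Primcodable D] [IsStrictOrderedRing D]
    {W : ℕ → ℕ} (hW : HasBoundedRescalings D W)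
    {V : Type} {α : Multiset D → V} {κ : ℕ → ℕ → Prop} {p q : ℕ → ℕ → ℕ}
    (hα : IsSumComparable α κ p q) (φ : CondIdentity D) :
    ValidIdentity α φ ↔
      ∀ l ∈ boundedLists D (W (Encodable.encode φ)) (Encodable.encode φ),
        SatConj (listAssignment l) φ.1 → SumCondition κ p q φ (listAssignment l) := by
  simp only [ValidIdentity, hα.eq_iff]
  refine ⟨fun h l _ hl => h _ hl, fun h δ hδ => ⟨?_, ?_⟩⟩
  -- The cardinality condition does not involve the assignment, so any bounded satisfying list gives
  -- it.
  · obtain ⟨l, hl, hs, -⟩ := exists_bounded_satConj hW φ hδ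
    exact (h l hl hs).1
  · by_contra hne
    obtain ⟨l, hl, hs, hne'⟩ := exists_bounded_sum_ne hW φ hδ hne
    exact hne' (h l hl hs).2

/-! ### Primitive recursiveness of the bounded tests -/

theorem primrec_listCodeBound : Primrec₂ listCodeBound :=
  Primrec.nat_rec' Primrec.snd (Primrec.const 0)
    (Primrec.succ.comp (Primrec₂.natPair.comp (Primrec.fst.comp Primrec.fst)
      (Primrec.snd.comp Primrec.snd))).to₂

theorem primrec_boundedLists [Primcodable D] : Primrec₂ (boundedLists D) :=
  Primrec.listFilterMap
    (Primrec.list_range.comp (Primrec.succ.comp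
      (primrec_listCodeBound.comp Primrec.fst (Primrec.succ.comp Primrec.snd))))
    (Primrec.decode.comp Primrec.snd).to₂

theorem primrec_eval_listAssignment [Zero D] [Primcodable D] :
    Primrec₂ fun (l : List D) (t : OTerm D) => OTerm.eval (listAssignment l) t := by
  have h : Primrec fun x : List D × OTerm D =>
      (Sum.casesOn x.2 (fun i => x.1.getD i 0) (fun d => d) : D) :=
    Primrec.sumCasesOn Primrec.snd
      ((Primrec.list_getD 0).comp (Primrec.fst.comp Primrec.fst) Primrec.snd).to₂
      Primrec.snd.to₂
  exact h.of_eq fun ⟨l, t⟩ => by cases t <;> rfl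

theorem primrecPred_holds [LinearOrder D] [Primcodable D] (hlt : PrimrecRel fun x y : D => x < y) :
    PrimrecPred fun x : OrdPred × D × D => x.1.Holds x.2.1 x.2.2 := by
  have a : Primrec fun x : OrdPred × D × D => x.2.1 := Primrec.fst.comp Primrec.snd
  have b : Primrec fun x : OrdPred × D × D => x.2.2 := Primrec.snd.comp Primrec.snd
  have i (ρ : OrdPred) : PrimrecPred fun x : OrdPred × D × D => x.1 = ρ :=
    Primrec.eq.comp Primrec.fst (Primrec.const ρ)
  have l : PrimrecPred fun x : OrdPred × D × D => x.2.1 < x.2.2 := hlt.comp a b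
  have g : PrimrecPred fun x : OrdPred × D × D => x.2.2 < x.2.1 := hlt.comp b a
  have e : PrimrecPred fun x : OrdPred × D × D => x.2.1 = x.2.2 := Primrec.eq.comp a b
  have h := ((i .lt).and l).or (((i .le).and g.not).or (((i .gt).and g).or
    (((i .ge).and l.not).or (((i .eq).and e).or ((i .ne).and e.not)))))
  refine h.of_eq fun ⟨ρ, x, y⟩ => ?_
  cases ρ <;> simp [OrdPred.Holds]

theorem primrecRel_sat [LinearOrder D] [CommRing D] [Primcodable D]
    (hlt : PrimrecRel fun x y : D => x < y) :
    PrimrecRel fun (a : OAtom D) (l : List D) => OAtom.Sat (listAssignment l) a :=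
  (primrecPred_holds hlt).comp (Primrec.pair (Primrec.fst.comp (Primrec.snd.comp Primrec.fst))
    (Primrec.pair
      (primrec_eval_listAssignment.comp Primrec.snd (Primrec.fst.comp Primrec.fst))
      (primrec_eval_listAssignment.comp Primrec.snd
        (Primrec.snd.comp (Primrec.snd.comp Primrec.fst)))))

theorem primrecRel_satConj [LinearOrder D] [CommRing D] [Primcodable D]
    (hlt : PrimrecRel fun x y : D => x < y) :
    PrimrecRel fun (L : List (OAtom D)) (l : List D) => SatConj (listAssignment l) L :=
  (primrecRel_sat hlt).forall_mem_list

theorem PrimrecPred.imp {β : Type} [Primcodable β] {r s : β → Prop} (hr : PrimrecPred r)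
    (hs : PrimrecPred s) : PrimrecPred fun x => r x → s x :=
  (hr.not.or hs).of_eq fun _ => imp_iff_not_or.symm

theorem PrimrecPred.forall_mem_fst {β γ : Type} [Primcodable β] [Primcodable γ] {r : β × γ → Prop}
    (hr : PrimrecPred r) : PrimrecPred fun x : List β × γ => ∀ b ∈ x.1, r (b, x.2) :=
  PrimrecRel.forall_mem_list (R := fun b c => r (b, c)) hr

theorem primrecRel_bounded_entails [LinearOrder D] [CommRing D] [Primcodable D]
    (hlt : PrimrecRel fun x y : D => x < y) (ρ : OrdPred) :
    PrimrecRel fun (M : List (List D)) (x : List (OAtom D) × OTerm D × OTerm D) =>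
      ∀ l ∈ M, SatConj (listAssignment l) x.1 →
        OAtom.Sat (listAssignment l) (x.2.1, ρ, x.2.2) := by
  have h : PrimrecRel fun (l : List D) (x : List (OAtom D) × OTerm D × OTerm D) =>
      SatConj (listAssignment l) x.1 → OAtom.Sat (listAssignment l) (x.2.1, ρ, x.2.2) :=
    PrimrecPred.imp
      ((primrecRel_satConj hlt).comp (Primrec.fst.comp Primrec.snd) Primrec.fst)
      ((primrecRel_sat hlt).comp
        (Primrec.pair (Primrec.fst.comp (Primrec.snd.comp Primrec.snd))
          (Primrec.pair (Primrec.const ρ) (Primrec.snd.comp (Primrec.snd.comp Primrec.snd))))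
        Primrec.fst)
  exact h.forall_mem_list

theorem primrecRel_sumCondition [CommRing D] [Primcodable D] {κ : ℕ → ℕ → Prop} {p q : ℕ → ℕ → ℕ}
    (hκ : PrimrecRel κ)
    (hp : Primrec₂ p) (hq : Primrec₂ q) (hsum : PrimrecSumEq D) :
    PrimrecRel fun (l : List D) (φ : CondIdentity D) =>
      SumCondition κ p q φ (listAssignment l) := by
  have B : Primrec fun x : List D × CondIdentity D => x.2.2.1 :=
    Primrec.fst.comp (Primrec.snd.comp Primrec.snd)
  have B' : Primrec fun x : List D × CondIdentity D => x.2.2.2 :=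
    Primrec.snd.comp (Primrec.snd.comp Primrec.snd)
  have n := Primrec.list_length.comp B
  have n' := Primrec.list_length.comp B'
  have ev : Primrec₂ fun (x : List D × CondIdentity D) (t : OTerm D) =>
      OTerm.eval (listAssignment x.1) t :=
    primrec_eval_listAssignment.comp (Primrec.fst.comp Primrec.fst) Primrec.snd
  exact (hκ.comp n n').and (hsum.comp (Primrec.pair (Primrec.pair (hp.comp n n') (hq.comp n n'))
    (Primrec.pair (Primrec.list_map B ev) (Primrec.list_map B' ev))))

theorem orderDecidable_of_isSumComparable [LinearOrder D] [CommRing D] [Primcodable D]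
    [IsStrictOrderedRing D] {W : ℕ → ℕ}
    (hW : HasBoundedRescalings D W) (hWp : Primrec W)
    (hlt : PrimrecRel fun x y : D => x < y) (hsum : PrimrecSumEq D)
    {V : Type} {α : Multiset D → V} {κ : ℕ → ℕ → Prop} {p q : ℕ → ℕ → ℕ}
    (hα : IsSumComparable α κ p q) (hκ : PrimrecRel κ) (hp : Primrec₂ p) (hq : Primrec₂ q) :
    OrderDecidable α := by
  have M : Primrec fun φ : CondIdentity D =>
      boundedLists D (W (Encodable.encode φ)) (Encodable.encode φ) :=
    primrec_boundedLists.comp (hWp.comp Primrec.encode) Primrec.encode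
  have L : Primrec fun φ : CondIdentity D => φ.1 := Primrec.fst
  have T : Primrec fun φ : CondIdentity D => φ.2.1 ++ φ.2.2 :=
    Primrec.list_append.comp (Primrec.fst.comp Primrec.snd) (Primrec.snd.comp Primrec.snd)
  have hempty : PrimrecPred fun φ : CondIdentity D => φ.2.1 ++ φ.2.2 = [] :=
    Primrec.eq.comp T (Primrec.const [])
  have hsat : PrimrecPred fun φ : CondIdentity D =>
      ∃ l ∈ boundedLists D (W (Encodable.encode φ)) (Encodable.encode φ),
        SatConj (listAssignment l) φ.1 := by
    have h : PrimrecRel fun (l : List D) (L : List (OAtom D)) => SatConj (listAssignment l) L :=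
      (primrecRel_satConj hlt).comp Primrec.snd Primrec.fst
    exact h.exists_mem_list.comp M L
  have hcomplete : PrimrecPred fun φ : CondIdentity D =>
      ∀ t ∈ φ.2.1 ++ φ.2.2, ∀ t' ∈ φ.2.1 ++ φ.2.2,
        (∀ l ∈ boundedLists D (W (Encodable.encode φ)) (Encodable.encode φ),
          SatConj (listAssignment l) φ.1 → OAtom.Sat (listAssignment l) (t, .lt, t')) ∨
        (∀ l ∈ boundedLists D (W (Encodable.encode φ)) (Encodable.encode φ),
          SatConj (listAssignment l) φ.1 → OAtom.Sat (listAssignment l) (t, .gt, t')) ∨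
        (∀ l ∈ boundedLists D (W (Encodable.encode φ)) (Encodable.encode φ),
          SatConj (listAssignment l) φ.1 → OAtom.Sat (listAssignment l) (t, .eq, t')) := by
    -- Here `y` is `(t', t, φ)`, innermost variable first, so that two uses of `forall_mem_fst` bind
    -- `t'` and then `t`.
    have e (ρ : OrdPred) : PrimrecPred fun y : OTerm D × OTerm D × CondIdentity D =>
        ∀ l ∈ boundedLists D (W (Encodable.encode y.2.2)) (Encodable.encode y.2.2),
          SatConj (listAssignment l) y.2.2.1 →
            OAtom.Sat (listAssignment l) (y.2.1, ρ, y.1) :=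
      (primrecRel_bounded_entails hlt ρ).comp
        (M.comp (Primrec.snd.comp Primrec.snd))
        (Primrec.pair (L.comp (Primrec.snd.comp Primrec.snd))
          (Primrec.pair (Primrec.fst.comp Primrec.snd) Primrec.fst))
    have h := (e .lt).or ((e .gt).or (e .eq))
    have h1 := h.forall_mem_fst.comp (Primrec.pair (T.comp Primrec.snd) Primrec.id)
    exact h1.forall_mem_fst.comp (Primrec.pair T Primrec.id)
  have hvalid : PrimrecPred fun φ : CondIdentity D =>
      ∀ l ∈ boundedLists D (W (Encodable.encode φ)) (Encodable.encode φ),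
        SatConj (listAssignment l) φ.1 → SumCondition κ p q φ (listAssignment l) := by
    have h : PrimrecRel fun (l : List D) (φ : CondIdentity D) =>
        SatConj (listAssignment l) φ.1 → SumCondition κ p q φ (listAssignment l) :=
      PrimrecPred.imp ((primrecRel_satConj hlt).comp (L.comp Primrec.snd) Primrec.fst)
        (primrecRel_sumCondition hκ hp hq hsum)
    exact h.forall_mem_list.comp M Primrec.id
  refine (hempty.or (hsat.and (hcomplete.and hvalid))).computablePred.of_eq fun φ => ?_
  rw [isOrderedIdentity_and_valid_iff, valid_iff_bounded hW hα]
  refine or_congr_right (and_congr ?_ (and_congr_left' ?_))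
  · exact ⟨fun ⟨l, _, hl⟩ => ⟨_, hl⟩, fun ⟨δ, hδ⟩ =>
      let ⟨l, hl, hs, _⟩ := exists_bounded_satConj hW φ hδ
      ⟨l, hl, hs⟩⟩
  · refine forall₂_congr fun t ht => forall₂_congr fun t' ht' => ?_
    rw [entails_iff_bounded hW φ _ ht ht', entails_iff_bounded hW φ _ ht ht',
      entails_iff_bounded hW φ _ ht ht']

end Decision

/-! ### The aggregates SUM and AVG -/

theorem isSumComparable_sum {D : Type} [CommRing D] :
    IsSumComparable (fun m : Multiset D => m.sum) (fun _ _ => True) (fun _ _ => 1)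
      (fun _ _ => 1) := by
  intro m m'
  simp

/-- If exactly one bag is empty, the cross-multiplied equation reads `0 = 0`; the condition on
cardinalities excludes this case. -/
theorem isSumComparable_avgRat :
    IsSumComparable avgRat (fun n n' => n = 0 ↔ n' = 0) (fun _ n' => n') (fun n _ => n) := by
  intro m m'
  unfold avgRat
  by_cases h : m.card = 0 <;> by_cases h' : m'.card = 0
  · simp [h, h']
  · simp [h, h']
  · simp [h, h']
  · have h1 : (m.card : ℚ) ≠ 0 := by exact_mod_cast h
    have h2 : (m'.card : ℚ) ≠ 0 := by exact_mod_cast h'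
    rw [if_neg h, if_neg h', Option.some_inj, div_eq_div_iff h1 h2]
    simp only [h, h', true_and, mul_comm]

theorem avgInt_eq_avgRat_map (m : Multiset ℤ) :
    avgInt m = avgRat (Multiset.map (Int.castRingHom ℚ) m) := by
  simp [avgInt, Multiset.bind_singleton]

theorem isSumComparable_avgInt :
    IsSumComparable avgInt (fun n n' => n = 0 ↔ n' = 0) (fun _ n' => n') (fun n _ => n) := by
  intro m m'
  rw [avgInt_eq_avgRat_map, avgInt_eq_avgRat_map, isSumComparable_avgRat, Multiset.card_map,
    Multiset.card_map, ← map_multiset_sum, ← map_multiset_sum]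
  refine and_congr_right fun _ => ?_
  simp only [eq_intCast]
  norm_cast

theorem primrec_factorial : Primrec Nat.factorial := by
  have h : Primrec fun n : ℕ => (Nat.rec 1 (fun k x => (k + 1) * x) n : ℕ) :=
    Primrec.nat_rec' Primrec.id (Primrec.const 1)
      (Primrec.nat_mul.comp (Primrec.succ.comp (Primrec.fst.comp Primrec.snd))
        (Primrec.snd.comp Primrec.snd)).to₂
  exact h.of_eq fun n => by induction n <;> simp_all [Nat.factorial_succ]

theorem primrec_rescalingBound_int : Primrec fun E : ℕ => 6 * E + 6 :=
  Primrec.nat_add.comp (Primrec.nat_mul.comp (Primrec.const 6) Primrec.id) (Primrec.const 6)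

theorem primrec_rescalingBound_rat : Primrec fun E : ℕ =>
    Nat.pair (2 * (2 * (E + 2) * (E * E.factorial) + 2 * E + 3)) (2 * (E + 2) * E.factorial) := by
  have a : Primrec fun E : ℕ => 2 * (E + 2) :=
    Primrec.nat_mul.comp (Primrec.const 2) (Primrec.nat_add.comp Primrec.id (Primrec.const 2))
  have b : Primrec fun E : ℕ => E * E.factorial := Primrec.nat_mul.comp Primrec.id primrec_factorial
  have c : Primrec fun E : ℕ => 2 * E := Primrec.nat_mul.comp (Primrec.const 2) Primrec.id
  exact Primrec₂.natPair.comp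
    (Primrec.nat_mul.comp (Primrec.const 2)
      (Primrec.nat_add.comp (Primrec.nat_add.comp (Primrec.nat_mul.comp a b) c) (Primrec.const 3)))
    (Primrec.nat_mul.comp a primrec_factorial)

theorem mainTheorem3 :
    OrderDecidable (D := ℤ) sumInt ∧ OrderDecidable (D := ℚ) sumRat ∧
      OrderDecidable (D := ℤ) avgInt ∧ OrderDecidable (D := ℚ) avgRat := by
  have htrue : PrimrecRel fun _ _ : ℕ => True :=
    (Primrec.eq.comp (Primrec.const 0) (Primrec.const 0)).of_eq fun _ => by simp
  have hzero : PrimrecRel fun n n' : ℕ => n = 0 ↔ n' = 0 := by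
    have h : PrimrecPred fun x : ℕ × ℕ => x.1 = 0 := Primrec.eq.comp Primrec.fst (Primrec.const 0)
    have h' : PrimrecPred fun x : ℕ × ℕ => x.2 = 0 := Primrec.eq.comp Primrec.snd (Primrec.const 0)
    exact ((h.and h').or (h.not.and h'.not)).of_eq fun x => by tauto
  have hone : Primrec₂ fun _ _ : ℕ => 1 := Primrec.const 1
  refine ⟨?_, ?_, ?_, ?_⟩
  · exact orderDecidable_of_isSumComparable hasBoundedRescalings_int primrec_rescalingBound_int
      primrecRel_int_lt primrecSumEq_int isSumComparable_sum htrue hone hone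
  · exact orderDecidable_of_isSumComparable hasBoundedRescalings_rat primrec_rescalingBound_rat
      primrecRel_rat_lt primrecSumEq_rat isSumComparable_sum htrue hone hone
  · exact orderDecidable_of_isSumComparable hasBoundedRescalings_int primrec_rescalingBound_int
      primrecRel_int_lt primrecSumEq_int isSumComparable_avgInt hzero Primrec.snd Primrec.fst
  · exact orderDecidable_of_isSumComparable hasBoundedRescalings_rat primrec_rescalingBound_rat
      primrecRel_rat_lt primrecSumEq_rat isSumComparable_avgRat hzero Primrec.snd Primrec.fst
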